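/- An odd continued fraction is a finite expression $$\left[0;\tfrac{\varepsilon_1}{a_1},\dots,\tfrac{\varepsilon_l}{a_l}\right]=\cfrac{\varepsilon_1}{a_1+\cfrac{\varepsilon_2}{a_2+\ldots+\cfrac{\varepsilon_l}{a_l}}}\qquad(l\ge 0;\ \text{value } 0 \text{ for } l=0),$$ where all $a_j$ are odd positive integers, $\varepsilon_j=\pm1$, $\varepsilon_1=1$, $a_j+\varepsilon_{j+1}\ge 2$ for $1\le j<l$, and $\varepsilon_l=1$ if $a_l=1$. Every $x\in\mathbb Q\cap[0,1]$ has exactly one such representation; let $S^0(x)=a_1+\dots+a_l$ be the sum of its partial quotients. For $n\in\mathbb N$ let $\mathcal Y_n=\{x\in\mathbb Q\cap[0,1]: S^0(x)\le n+1\}$, and for $x\in[0,1]$ put $$F^0_n(x)=\frac{\sharp\{\xi\in\mathcal Y_n:\xi\le x\}}{\sharp\,\mathcal Y_n},\qquad F^0(x)=\lim_{n\to\infty}F^0_n(x).$$ Let $\lambda$ be the unique real root of $\lambda^3-\lambda^2-\lambda-1=0$. Proposition 2. The limit $F^0(x)$ exists for every $x\in[0,1]$, and for every integer $n\ge1$ and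 every $x\in[0,1]$ $$\frac{F^0(x)}{\lambda^{2n-1}}=\frac1{\lambda^{2n-2}}-F^0\!\left(\frac1{2n-1+x}\right),\qquad \frac{F^0(x)}{\lambda^{2n}}=F^0\!\left(\frac1{2n+\frac1x}\right),$$ where for $x=0$ the argument $\frac{1}{2n+1/x}$ is read as $0$. -/

import Mathlib

open Filter Topology

namespace OddCF

/-- The value of the finite continued fraction
`[0; ε₁/a₁, …, ε_l/a_l] = ε₁/(a₁ + ε₂/(a₂ + ⋯ + ε_l/a_l))`,
given as the list of the pairs `(ε_j, a_j)`; the empty list stands for `0`. -/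
def value : List (ℤ × ℕ) → ℚ
  | [] => 0
  | (e, a) :: t => (e : ℚ) / ((a : ℚ) + value t)

/-- `[0; ε₁/a₁, …, ε_l/a_l]` is a (finite) odd continued fraction: every `ε_j` is `±1` and every
`a_j` is odd, `ε₁ = 1`, `a_j + ε_{j+1} ≥ 2`, and if the last partial quotient `a_l` is `1`
then `ε_l = 1`. -/
def IsOddCF (l : List (ℤ × ℕ)) : Prop :=
  (∀ p ∈ l, (p.1 = 1 ∨ p.1 = -1) ∧ Odd p.2) ∧
  (∀ p ∈ l.head?, p.1 = 1) ∧
  l.IsChain (fun p q => 2 ≤ (p.2 : ℤ) + q.1) ∧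
  (∀ p ∈ l.getLast?, p.2 = 1 → p.1 = 1)

/-- The sum `a₁ + ⋯ + a_l` of the partial quotients. -/
def quotientSum (l : List (ℤ × ℕ)) : ℕ := (l.map Prod.snd).sum

/-- The set of the rationals in `[0, 1]` whose odd continued fraction has sum of partial
quotients at most `n + 1`. -/
def Y (n : ℕ) : Set ℚ :=
  {x | (0 ≤ x ∧ x ≤ 1) ∧ ∃ l, IsOddCF l ∧ value l = x ∧ quotientSum l ≤ n + 1}

/-- The distribution function of the finite set `Y n`: the proportion of its elements `≤ x`. -/
noncomputable def Fn (n : ℕ) (x : ℝ) : ℝ :=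
  ({ξ ∈ Y n | (ξ : ℝ) ≤ x}.ncard : ℝ) / ((Y n).ncard : ℝ)

/-- The limit distribution function `F⁰(x) = lim_{n → ∞} Fn n x`. -/
noncomputable def F0 (x : ℝ) : ℝ := limUnder atTop (fun n => Fn n x)

end OddCF

/-!
In the coordinate `z = 1 / x` the branches `z ↦ z + 2`, `z ↦ 3 - 1 / z` and `z ↦ 1 + 1 / z` generate
all odd continued fractions from `0`. They are monotone or antitone, have images `[0, 1/3]`,
`[1/3, 1/2]` and `[1/2, 1]`, and add `2`, `3` and `1` to the sum of the partial quotients. Hence the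
number `count m x` of rationals `≤ x` with sum at most `m` satisfies a recursion along each branch.
At `x = 1` these combine to the tribonacci recurrence for `count m 1 - 1`. Its characteristic roots
other than `lam` have modulus less than `1`, so `count (m + 1) 1 - lam * count m 1` is bounded.
Descending along the branches, `count (m + 1) x - lam * count m x` is `O(m)`, which makes
`count m x / lam ^ m` converge. In the limit the recursions become
`F0 (1 / (2 + 1 / x)) = F0 x / lam ^ 2` and `F0 (1 / (1 + x)) = 1 - F0 x / lam`, and iterating the
first gives both functional equations.
-/

namespace OddCF

open Set

theorem ncard_inter_Iic_add_ncard_inter_Ici {α : Type*} [LinearOrder α] {s : Set α}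
    (hs : s.Finite) (a : α) :
    (s ∩ Iic a).ncard + (s ∩ Ici a).ncard = s.ncard + (s ∩ {a}).ncard := by
  rw [← ncard_union_add_ncard_inter _ _ (hs.inter_of_left _) (hs.inter_of_left _),
    ← inter_union_distrib_left, Iic_union_Ici, inter_univ, ← inter_inter_distrib_left,
    inter_comm (Iic a), Ici_inter_Iic, Icc_self]

theorem ncard_inter_singleton_le_one {α : Type*} (s : Set α) (a : α) : (s ∩ {a}).ncard ≤ 1 :=
  (ncard_le_ncard inter_subset_right).trans (ncard_singleton a).le

theorem exists_tendsto_div_pow {r : ℝ} (hr : 0 < r) {a b : ℕ → ℝ}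
    (hab : ∀ m, |a (m + 1) - r * a m| ≤ b m) (hb : Summable fun m => b m / r ^ (m + 1)) :
    ∃ L, Tendsto (fun m => a m / r ^ m) atTop (𝓝 L) := by
  refine cauchySeq_tendsto_of_complete (cauchySeq_of_dist_le_of_summable _ (fun m => ?_) hb)
  have hdiff : a (m + 1) / r ^ (m + 1) - a m / r ^ m = (a (m + 1) - r * a m) / r ^ (m + 1) := by
    rw [pow_succ]
    field_simp
  rw [dist_comm, Real.dist_eq, hdiff, abs_div, abs_of_pos (pow_pos hr _)]
  gcongr
  exact hab m

theorem summable_add_mul_div_pow {r : ℝ} (hr : 1 < r) (B C : ℝ) :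
    Summable fun m : ℕ => (B + C * m) / r ^ (m + 1) := by
  have hnorm : ‖r⁻¹‖ < 1 := by
    rw [Real.norm_eq_abs, abs_of_pos (by positivity)]
    exact inv_lt_one_of_one_lt₀ hr
  have hgeom := (summable_geometric_of_norm_lt_one hnorm).mul_left (B / r)
  have hlin := (summable_pow_mul_geometric_of_norm_lt_one 1 hnorm).mul_left (C / r)
  refine (hgeom.add hlin).congr fun m => ?_
  rw [inv_pow, pow_one, pow_succ]
  field_simp

theorem exists_abs_le_of_recurrence {p q : ℝ} (hdisc : p ^ 2 < 4 * q) (hq : q ≤ 1) {e : ℕ → ℝ}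
    (he : ∀ m, e (m + 2) + p * e (m + 1) + q * e m = 0) : ∃ K, ∀ m, |e m| ≤ K := by
  -- `Q` is a Lyapunov function: the recurrence multiplies it by `q`, and it is positive definite
  -- because the characteristic polynomial has negative discriminant.
  set Q : ℕ → ℝ := fun m => e (m + 1) ^ 2 + p * e (m + 1) * e m + q * e m ^ 2 with hQ
  have hQ_succ (m : ℕ) : Q (m + 1) = q * Q m := by
    have hnext : e (m + 2) = -(p * e (m + 1) + q * e m) := by linarith [he m]
    simp only [hQ, hnext]
    ring
  have hc : 0 < q - p ^ 2 / 4 := by linarith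
  have hQ_lower (m : ℕ) : (q - p ^ 2 / 4) * e m ^ 2 ≤ Q m := by
    have : Q m = (e (m + 1) + p / 2 * e m) ^ 2 + (q - p ^ 2 / 4) * e m ^ 2 := by
      simp only [hQ]
      ring
    linarith [sq_nonneg (e (m + 1) + p / 2 * e m)]
  have hQ_nonneg (m : ℕ) : 0 ≤ Q m := le_trans (by positivity) (hQ_lower m)
  have hQ_anti : Antitone Q := antitone_nat_of_succ_le fun m => by
    rw [hQ_succ]
    exact mul_le_of_le_one_left (hQ_nonneg m) hq
  refine ⟨√(Q 0 / (q - p ^ 2 / 4)), fun m => Real.abs_le_sqrt ?_⟩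
  rw [le_div_iff₀' hc]
  exact (hQ_lower m).trans (hQ_anti (Nat.zero_le m))

theorem five_thirds_lt_of_tribonacci {lam : ℝ} (hlam : lam ^ 3 - lam ^ 2 - lam - 1 = 0) :
    5 / 3 < lam := by
  by_contra! h
  nlinarith [mul_nonneg (sub_nonneg.2 h) (sq_nonneg lam)]

theorem one_lt_of_tribonacci {lam : ℝ} (hlam : lam ^ 3 - lam ^ 2 - lam - 1 = 0) : 1 < lam := by
  linarith [five_thirds_lt_of_tribonacci hlam]

theorem lt_two_of_tribonacci {lam : ℝ} (hlam : lam ^ 3 - lam ^ 2 - lam - 1 = 0) : lam < 2 := by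
  by_contra! h
  nlinarith [mul_nonneg (sub_nonneg.2 h) (sq_nonneg lam)]

theorem exists_abs_sub_mul_le_of_tribonacci {lam : ℝ} (hlam : lam ^ 3 - lam ^ 2 - lam - 1 = 0)
    {u : ℕ → ℝ} (hu : ∀ m, u (m + 3) = u (m + 2) + u (m + 1) + u m) :
    ∃ K, ∀ m, |u (m + 1) - lam * u m| ≤ K := by
  have h2 := lt_two_of_tribonacci hlam
  have h53 := five_thirds_lt_of_tribonacci hlam
  -- `lam` splits off: `z³ - z² - z - 1 = (z - lam) (z² + (lam - 1) z + (lam² - lam - 1))`.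
  refine exists_abs_le_of_recurrence (p := lam - 1) (q := lam ^ 2 - lam - 1) ?_ ?_ fun m => ?_
  · nlinarith [mul_pos (sub_pos.2 h53) (by linarith : 0 < lam + 1)]
  · nlinarith [mul_pos (sub_pos.2 h2) (by linarith : 0 < lam + 1)]
  · rw [hu]
    linear_combination -u m * hlam

theorem mul_pow_le_of_tribonacci {lam c : ℝ} (hlam : lam ^ 3 - lam ^ 2 - lam - 1 = 0) {u : ℕ → ℝ}
    (hu : ∀ m, u (m + 3) = u (m + 2) + u (m + 1) + u m) (hinit : ∀ m < 3, c * lam ^ m ≤ u m)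
    (m : ℕ) : c * lam ^ m ≤ u m := by
  induction m using Nat.strong_induction_on with
  | _ m ih =>
    obtain hm | ⟨k, rfl⟩ : m < 3 ∨ ∃ k, m = k + 3 :=
      (lt_or_ge m 3).imp_right Nat.exists_eq_add_of_le'
    · exact hinit m hm
    · have hpow : c * lam ^ (k + 3) = c * lam ^ (k + 2) + c * lam ^ (k + 1) + c * lam ^ k := by
        linear_combination c * lam ^ k * hlam
      rw [hpow, hu]
      gcongr <;> exact ih _ (by omega)

/-- The map `z ↦ z + 2` in the coordinate `z = 1 / x`. It adds `2` to the first partial quotient of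
an odd continued fraction, and takes `[0, 1]` onto `[0, 1/3]`. -/
noncomputable def lowBranch (x : ℝ) : ℝ := x / (1 + 2 * x)

/-- The map `[0; 1/a₁, …] ↦ [0; 1/3, -1/a₁, …]` on odd continued fractions, which takes `[0, 1]`
onto `[1/3, 1/2]`. -/
noncomputable def midBranch (x : ℝ) : ℝ := 1 / (3 - x)

/-- The map `[0; 1/a₁, …] ↦ [0; 1/1, 1/a₁, …]` on odd continued fractions, which reverses the order
and takes `[0, 1]` onto `[1/2, 1]`. -/
noncomputable def topBranch (x : ℝ) : ℝ := 1 / (1 + x)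

@[simp] theorem lowBranch_zero : lowBranch 0 = 0 := by simp [lowBranch]

@[simp] theorem lowBranch_one : lowBranch 1 = 1 / 3 := by norm_num [lowBranch]

@[simp] theorem midBranch_zero : midBranch 0 = 1 / 3 := by simp [midBranch]

@[simp] theorem midBranch_one : midBranch 1 = 1 / 2 := by norm_num [midBranch]

@[simp] theorem topBranch_zero : topBranch 0 = 1 := by simp [topBranch]

@[simp] theorem topBranch_one : topBranch 1 = 1 / 2 := by norm_num [topBranch]

theorem strictMonoOn_lowBranch : StrictMonoOn lowBranch (Ici 0) := by
  intro x (hx : 0 ≤ x) y (hy : 0 ≤ y) hxy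
  rw [lowBranch, lowBranch, div_lt_div_iff₀ (by positivity) (by positivity)]
  linarith

theorem strictMonoOn_midBranch : StrictMonoOn midBranch (Iic 1) := by
  intro x _ y (hy : y ≤ 1) hxy
  exact one_div_lt_one_div_of_lt (by linarith) (by linarith)

theorem strictAntiOn_topBranch : StrictAntiOn topBranch (Ici 0) := by
  intro x (hx : 0 ≤ x) y _ hxy
  exact one_div_lt_one_div_of_lt (by linarith) (by linarith)

theorem mapsTo_lowBranch : MapsTo lowBranch (Icc 0 1) (Icc 0 (1 / 3)) := by
  have h := strictMonoOn_lowBranch.monotoneOn.mono (Icc_subset_Ici_self : Icc (0 : ℝ) 1 ⊆ _)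
  simpa only [lowBranch_zero, lowBranch_one] using h.mapsTo_Icc

theorem mapsTo_midBranch : MapsTo midBranch (Icc 0 1) (Icc (1 / 3) (1 / 2)) := by
  have h := strictMonoOn_midBranch.monotoneOn.mono (Icc_subset_Iic_self : Icc (0 : ℝ) 1 ⊆ _)
  simpa only [midBranch_zero, midBranch_one] using h.mapsTo_Icc

theorem mapsTo_topBranch : MapsTo topBranch (Icc 0 1) (Icc (1 / 2) 1) := by
  have h := strictAntiOn_topBranch.antitoneOn.mono (Icc_subset_Ici_self : Icc (0 : ℝ) 1 ⊆ _)
  simpa only [topBranch_zero, topBranch_one] using h.mapsTo_Icc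

theorem lowBranch_mem_Icc {x : ℝ} (hx : x ∈ Icc (0 : ℝ) 1) : lowBranch x ∈ Icc (0 : ℝ) 1 :=
  Icc_subset_Icc_right (by norm_num) (mapsTo_lowBranch hx)

theorem midBranch_mem_Icc {x : ℝ} (hx : x ∈ Icc (0 : ℝ) 1) : midBranch x ∈ Icc (0 : ℝ) 1 :=
  Icc_subset_Icc (by norm_num) (by norm_num) (mapsTo_midBranch hx)

theorem topBranch_mem_Icc {x : ℝ} (hx : x ∈ Icc (0 : ℝ) 1) : topBranch x ∈ Icc (0 : ℝ) 1 :=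
  Icc_subset_Icc_left (by norm_num) (mapsTo_topBranch hx)

theorem lowBranch_one_div {z : ℝ} (hz : 0 < z) : lowBranch (1 / z) = 1 / (2 + z) := by
  rw [lowBranch]
  field_simp
  ring

theorem lowBranch_iterate_one_div {z : ℝ} (hz : 0 < z) (n : ℕ) :
    lowBranch^[n] (1 / z) = 1 / (2 * n + z) := by
  induction n with
  | zero => simp
  | succ n ih =>
    rw [Function.iterate_succ_apply', ih, lowBranch_one_div (by positivity)]
    push_cast
    ring

theorem exists_branch_eq {x : ℝ} (hx : x ∈ Icc (0 : ℝ) 1) :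
    ∃ y ∈ Icc (0 : ℝ) 1, lowBranch y = x ∨ midBranch y = x ∨ topBranch y = x := by
  obtain ⟨h0, h1⟩ := hx
  rcases le_or_gt x (1 / 3) with h3 | h3
  · have hd : 0 < 1 - 2 * x := by linarith
    refine ⟨x / (1 - 2 * x), ⟨by positivity, (div_le_one hd).2 (by linarith)⟩, Or.inl ?_⟩
    have hden : 1 + 2 * (x / (1 - 2 * x)) = 1 / (1 - 2 * x) := by field_simp; ring
    rw [lowBranch, hden, div_div_div_cancel_right₀ hd.ne', div_one]
  rcases le_or_gt x (1 / 2) with h2 | h2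
  · refine ⟨3 - 1 / x, ⟨?_, ?_⟩, Or.inr (Or.inl (by simp [midBranch]))⟩
    · rw [sub_nonneg, div_le_iff₀ (by linarith)]
      linarith
    · rw [sub_le_comm, le_div_iff₀ (by linarith)]
      linarith
  · refine ⟨1 / x - 1, ⟨?_, ?_⟩, Or.inr (Or.inr (by simp [topBranch]))⟩
    · rw [sub_nonneg, le_div_iff₀ (by linarith)]
      linarith
    · rw [sub_le_iff_le_add, div_le_iff₀ (by linarith)]
      linarith

/-- `IsOddRat m x` says that `x` is a rational in `[0, 1]`, seen as a real number, whose odd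
continued fraction has sum of partial quotients at most `m`. These are generated from `0` by the
three branches. The argument `1` of `mid` is allowed although `[0; 1/3, -1/1]` is inadmissible: its
value `midBranch 1 = topBranch 1` has the admissible expansion `[0; 1/1, 1/1]` of smaller sum. -/
inductive IsOddRat : ℕ → ℝ → Prop
  | zero (m : ℕ) : IsOddRat m 0
  | low {m : ℕ} {x : ℝ} : IsOddRat m x → IsOddRat (m + 2) (lowBranch x)
  | mid {m : ℕ} {x : ℝ} : IsOddRat m x → IsOddRat (m + 3) (midBranch x)
  | top {m : ℕ} {x : ℝ} : IsOddRat m x → IsOddRat (m + 1) (topBranch x)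

namespace IsOddRat

variable {m n : ℕ} {x : ℝ}

theorem mem_Icc (h : IsOddRat m x) : x ∈ Icc (0 : ℝ) 1 := by
  induction h with
  | zero => simp
  | low _ ih => exact lowBranch_mem_Icc ih
  | mid _ ih => exact midBranch_mem_Icc ih
  | top _ ih => exact topBranch_mem_Icc ih

theorem mono (h : IsOddRat m x) (hmn : m ≤ n) : IsOddRat n x := by
  induction h generalizing n with
  | zero m => exact zero n
  | @low m x _ ih =>
    obtain ⟨k, rfl⟩ := Nat.exists_eq_add_of_le' hmn
    exact (ih (Nat.le_add_left m k)).low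
  | @mid m x _ ih =>
    obtain ⟨k, rfl⟩ := Nat.exists_eq_add_of_le' hmn
    exact (ih (Nat.le_add_left m k)).mid
  | @top m x _ ih =>
    obtain ⟨k, rfl⟩ := Nat.exists_eq_add_of_le' hmn
    exact (ih (Nat.le_add_left m k)).top

theorem one (m : ℕ) : IsOddRat (m + 1) 1 := by
  simpa using (zero m).top

theorem low_iterate (h : IsOddRat m x) (n : ℕ) : IsOddRat (m + 2 * n) (lowBranch^[n] x) := by
  induction n with
  | zero => exact h
  | succ n ih =>
    rw [Function.iterate_succ_apply']
    exact ih.low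

theorem exists_lowBranch_eq (h : IsOddRat (m + 2) x) (hx : x ≤ 1 / 3) :
    ∃ y, IsOddRat m y ∧ lowBranch y = x := by
  cases h with
  | zero => exact ⟨0, zero m, lowBranch_zero⟩
  | @low _ y hy => exact ⟨y, hy, rfl⟩
  | @mid m y hy =>
    exact ⟨1, one m, lowBranch_one.trans ((mapsTo_midBranch hy.mem_Icc).1.antisymm hx)⟩
  | top hy => linarith [(mapsTo_topBranch hy.mem_Icc).1]

theorem exists_midBranch_eq (h : IsOddRat (m + 4) x) (hx : x ∈ Icc (1 / 3 : ℝ) (1 / 2)) :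
    ∃ y, IsOddRat (m + 1) y ∧ midBranch y = x := by
  cases h with
  | zero => norm_num at hx
  | low hy =>
    exact ⟨0, zero _, midBranch_zero.trans (hx.1.antisymm (mapsTo_lowBranch hy.mem_Icc).2)⟩
  | @mid _ y hy => exact ⟨y, hy, rfl⟩
  | top hy =>
    exact ⟨1, one m, midBranch_one.trans ((mapsTo_topBranch hy.mem_Icc).1.antisymm hx.2)⟩

theorem exists_topBranch_eq (h : IsOddRat (m + 1) x) (hx : 1 / 2 ≤ x) :
    ∃ y, IsOddRat m y ∧ topBranch y = x := by
  cases h with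
  | zero => norm_num at hx
  | low hy => linarith [(mapsTo_lowBranch hy.mem_Icc).2]
  | @mid m y hy =>
    exact ⟨1, one _, topBranch_one.trans (hx.antisymm (mapsTo_midBranch hy.mem_Icc).2)⟩
  | @top _ y hy => exact ⟨y, hy, rfl⟩

end IsOddRat

theorem quotientSum_cons (e : ℤ) (a : ℕ) (t : List (ℤ × ℕ)) :
    quotientSum ((e, a) :: t) = a + quotientSum t := by
  simp [quotientSum]

theorem isOddCF_singleton {a : ℕ} : IsOddCF [(1, a)] ↔ Odd a := by simp [IsOddCF]

theorem isOddCF_cons_cons {a b : ℕ} {e : ℤ} {t : List (ℤ × ℕ)} :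
    IsOddCF ((1, a) :: (e, b) :: t) ↔
      Odd a ∧ (e = 1 ∨ e = -1) ∧ 2 ≤ (a : ℤ) + e ∧ (t = [] → b = 1 → e = 1) ∧
        IsOddCF ((1, b) :: t) := by
  cases t <;> simp [IsOddCF, List.getLast?_cons_cons] <;> tauto

theorem IsOddCF.eq_one_of_cons {e : ℤ} {a : ℕ} {t : List (ℤ × ℕ)} (h : IsOddCF ((e, a) :: t)) :
    e = 1 :=
  h.2.1 (e, a) (by simp)

theorem IsOddCF.one_cons {l : List (ℤ × ℕ)} (h : IsOddCF l) : IsOddCF ((1, 1) :: l) := by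
  match l with
  | [] => exact isOddCF_singleton.2 odd_one
  | (e, b) :: t =>
    obtain rfl := h.eq_one_of_cons
    exact isOddCF_cons_cons.2 ⟨odd_one, Or.inl rfl, le_rfl, fun _ _ => rfl, h⟩

theorem IsOddCF.add_two {a : ℕ} {t : List (ℤ × ℕ)} (h : IsOddCF ((1, a) :: t)) :
    IsOddCF ((1, a + 2) :: t) := by
  match t with
  | [] => exact isOddCF_singleton.2 ((isOddCF_singleton.1 h).add_even even_two)
  | (e, b) :: t =>
    obtain ⟨ha, he, hae, ht⟩ := isOddCF_cons_cons.1 h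
    exact isOddCF_cons_cons.2 ⟨ha.add_even even_two, he, by push_cast; linarith, ht⟩

theorem isOddRat_one_div_add {m a : ℕ} {y : ℝ} (ha : Odd a) (h : IsOddRat m y) :
    IsOddRat (a + m) (1 / (a + y)) := by
  obtain ⟨k, rfl⟩ := ha
  have hy := h.mem_Icc.1
  convert h.top.low_iterate k using 1
  · ring
  · rw [topBranch, lowBranch_iterate_one_div (by linarith)]
    push_cast
    ring

theorem isOddRat_one_div_sub {m a : ℕ} {y : ℝ} (ha : Odd a) (ha3 : 3 ≤ a) (h : IsOddRat m y) :
    IsOddRat (a + m) (1 / (a - y)) := by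
  obtain ⟨k, rfl⟩ : ∃ k, a = 2 * k + 3 := by
    obtain ⟨k, rfl⟩ := ha
    exact ⟨k - 1, by omega⟩
  have hy := h.mem_Icc.2
  convert h.mid.low_iterate k using 1
  · ring
  · rw [midBranch, lowBranch_iterate_one_div (by linarith)]
    push_cast
    ring

theorem IsOddCF.isOddRat_cons {t : List (ℤ × ℕ)} {a : ℕ} (h : IsOddCF ((1, a) :: t)) :
    IsOddRat (quotientSum ((1, a) :: t)) (value ((1, a) :: t)) := by
  induction t generalizing a with
  | nil => simpa [value, quotientSum] using isOddRat_one_div_add (isOddCF_singleton.1 h) (.zero 0)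
  | cons p t ih =>
    obtain ⟨e, b⟩ := p
    obtain ⟨ha, rfl | rfl, hae, -, ht⟩ := isOddCF_cons_cons.1 h
    · simpa [value, quotientSum] using isOddRat_one_div_add ha (ih ht)
    · have ha3 : 3 ≤ a := by omega
      simpa [value, quotientSum, sub_eq_add_neg, neg_div] using
        isOddRat_one_div_sub ha ha3 (ih ht)

theorem IsOddCF.isOddRat {l : List (ℤ × ℕ)} (h : IsOddCF l) :
    IsOddRat (quotientSum l) (value l) := by
  match l with
  | [] => simpa [value] using IsOddRat.zero _
  | (e, a) :: t =>
    obtain rfl := h.eq_one_of_cons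
    exact h.isOddRat_cons

theorem exists_isOddCF_lowBranch {l : List (ℤ × ℕ)} (h : IsOddCF l) (h0 : (0 : ℝ) ≤ value l) :
    ∃ l', IsOddCF l' ∧ (value l' : ℝ) = lowBranch (value l) ∧
      quotientSum l' ≤ quotientSum l + 2 := by
  rcases h0.eq_or_lt with h0 | h0
  · exact ⟨[], by simp [IsOddCF], by simp [← h0, value], by simp [quotientSum]⟩
  match l with
  | [] => simp [value] at h0
  | (e, a) :: t =>
    obtain rfl := h.eq_one_of_cons
    simp only [value, Int.cast_one, Rat.cast_div, Rat.cast_one, Rat.cast_add, Rat.cast_natCast,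
      one_div_pos] at h0
    refine ⟨(1, a + 2) :: t, h.add_two, ?_, by simp only [quotientSum_cons]; omega⟩
    simp only [value]
    push_cast
    rw [lowBranch_one_div h0]
    ring

theorem exists_isOddCF_midBranch {l : List (ℤ × ℕ)} (h : IsOddCF l) :
    ∃ l', IsOddCF l' ∧ (value l' : ℝ) = midBranch (value l) ∧
      quotientSum l' ≤ quotientSum l + 3 := by
  match l with
  | [] => exact ⟨[(1, 3)], isOddCF_singleton.2 (by decide), by simp [value], by simp [quotientSum]⟩
  | (e, b) :: t =>
    obtain rfl := h.eq_one_of_cons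
    by_cases hone : t = [] ∧ b = 1
    · obtain ⟨rfl, rfl⟩ := hone
      exact ⟨[(1, 1), (1, 1)], h.one_cons, by norm_num [value], by simp [quotientSum]⟩
    · refine ⟨(1, 3) :: (-1, b) :: t, isOddCF_cons_cons.2 ⟨by decide, Or.inr rfl, by norm_num,
        fun ht hb => absurd ⟨ht, hb⟩ hone, h⟩, ?_, by simp only [quotientSum_cons]; omega⟩
      simp [value, midBranch, sub_eq_add_neg, neg_div]

theorem IsOddRat.exists_isOddCF {m : ℕ} {x : ℝ} (h : IsOddRat m x) :
    ∃ l, IsOddCF l ∧ (value l : ℝ) = x ∧ quotientSum l ≤ m := by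
  induction h with
  | zero m => exact ⟨[], by simp [IsOddCF], by simp [value], by simp [quotientSum]⟩
  | low hx ih =>
    obtain ⟨l, hl, rfl, hs⟩ := ih
    obtain ⟨l', hl', hv, hs'⟩ := exists_isOddCF_lowBranch hl hx.mem_Icc.1
    exact ⟨l', hl', hv, by omega⟩
  | mid _ ih =>
    obtain ⟨l, hl, rfl, hs⟩ := ih
    obtain ⟨l', hl', hv, hs'⟩ := exists_isOddCF_midBranch hl
    exact ⟨l', hl', hv, by omega⟩
  | top _ ih =>
    obtain ⟨l, hl, rfl, hs⟩ := ih
    exact ⟨(1, 1) :: l, hl.one_cons, by simp [value, topBranch], by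
      simp only [quotientSum_cons]; omega⟩

/-- The set of the rationals counted by `OddCF.Y`, as real numbers, indexed by the bound itself:
`oddRats (n + 1)` is the image of `Y n`. -/
def oddRats (m : ℕ) : Set ℝ := {x | IsOddRat m x}

theorem image_ratCast_Y (n : ℕ) : ((↑) : ℚ → ℝ) '' Y n = oddRats (n + 1) := by
  ext x
  constructor
  · rintro ⟨_, ⟨-, l, hl, rfl, hs⟩, rfl⟩
    exact hl.isOddRat.mono hs
  · intro (h : IsOddRat (n + 1) x)
    obtain ⟨l, hl, rfl, hs⟩ := h.exists_isOddCF
    obtain ⟨h0, h1⟩ := h.mem_Icc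
    exact ⟨value l, ⟨⟨by exact_mod_cast h0, by exact_mod_cast h1⟩, l, hl, rfl, hs⟩, rfl⟩

theorem finite_oddRats (m : ℕ) : (oddRats m).Finite := by
  induction m using Nat.strong_induction_on with
  | _ m ih =>
    have hbranch (f : ℝ → ℝ) : (⋃ k ∈ Iio m, f '' oddRats k).Finite :=
      (finite_Iio m).biUnion fun k hk => (ih k hk).image f
    refine ((finite_singleton 0).union ((hbranch lowBranch).union
      ((hbranch midBranch).union (hbranch topBranch)))).subset fun x hx => ?_
    simp only [mem_union, mem_singleton_iff, mem_iUnion, mem_Iio, mem_image]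
    cases (hx : IsOddRat m x) with
    | zero => exact Or.inl rfl
    | @low k y hy => exact Or.inr (Or.inl ⟨k, by omega, y, hy, rfl⟩)
    | @mid k y hy => exact Or.inr (Or.inr (Or.inl ⟨k, by omega, y, hy, rfl⟩))
    | @top k y hy => exact Or.inr (Or.inr (Or.inr ⟨k, by omega, y, hy, rfl⟩))

theorem bijOn_lowBranch (m : ℕ) {x : ℝ} (hx : x ∈ Icc (0 : ℝ) 1) :
    BijOn lowBranch (oddRats m ∩ Iic x) (oddRats (m + 2) ∩ Iic (lowBranch x)) := by
  have hle {y : ℝ} (hy : IsOddRat m y) : lowBranch y ≤ lowBranch x ↔ y ≤ x :=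
    strictMonoOn_lowBranch.le_iff_le hy.mem_Icc.1 hx.1
  refine ⟨fun y hy => ⟨hy.1.low, (hle hy.1).2 hy.2⟩,
    strictMonoOn_lowBranch.injOn.mono fun y hy => hy.1.mem_Icc.1, ?_⟩
  rintro _ ⟨hz, hzx⟩
  obtain ⟨y, hy, rfl⟩ := hz.exists_lowBranch_eq (hzx.trans (mapsTo_lowBranch hx).2)
  exact ⟨y, ⟨hy, (hle hy).1 hzx⟩, rfl⟩

theorem bijOn_midBranch (m : ℕ) {x : ℝ} (hx : x ∈ Icc (0 : ℝ) 1) :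
    BijOn midBranch (oddRats (m + 1) ∩ Iic x)
      (oddRats (m + 4) ∩ Iic (midBranch x) ∩ Ici (1 / 3)) := by
  have hle {y : ℝ} (hy : IsOddRat (m + 1) y) : midBranch y ≤ midBranch x ↔ y ≤ x :=
    strictMonoOn_midBranch.le_iff_le hy.mem_Icc.2 hx.2
  refine ⟨fun y hy => ⟨⟨hy.1.mid, (hle hy.1).2 hy.2⟩, (mapsTo_midBranch hy.1.mem_Icc).1⟩,
    strictMonoOn_midBranch.injOn.mono fun y hy => hy.1.mem_Icc.2, ?_⟩
  rintro _ ⟨⟨hz, hzx⟩, hz3⟩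
  obtain ⟨y, hy, rfl⟩ := hz.exists_midBranch_eq ⟨hz3, hzx.trans (mapsTo_midBranch hx).2⟩
  exact ⟨y, ⟨hy, (hle hy).1 hzx⟩, rfl⟩

theorem bijOn_topBranch (m : ℕ) {x : ℝ} (hx : x ∈ Icc (0 : ℝ) 1) :
    BijOn topBranch (oddRats m ∩ Iic x) (oddRats (m + 1) ∩ Ici (topBranch x)) := by
  have hle {y : ℝ} (hy : IsOddRat m y) : topBranch x ≤ topBranch y ↔ y ≤ x :=
    strictAntiOn_topBranch.le_iff_ge hx.1 hy.mem_Icc.1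
  refine ⟨fun y hy => ⟨hy.1.top, (hle hy.1).2 hy.2⟩,
    strictAntiOn_topBranch.injOn.mono fun y hy => hy.1.mem_Icc.1, ?_⟩
  rintro _ ⟨hz, hzx⟩
  obtain ⟨y, hy, rfl⟩ := hz.exists_topBranch_eq ((mapsTo_topBranch hx).1.trans hzx)
  exact ⟨y, ⟨hy, (hle hy).1 hzx⟩, rfl⟩

/-- The number of elements `≤ x` of `oddRats m`: the numerator of `Fn n x` is `count (n + 1) x`. -/
noncomputable def count (m : ℕ) (x : ℝ) : ℕ := (oddRats m ∩ Iic x).ncard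

theorem count_one (m : ℕ) : count m 1 = (oddRats m).ncard := by
  have hsub : oddRats m ⊆ Iic 1 := fun x hx => (IsOddRat.mem_Icc hx).2
  rw [count, inter_eq_left.2 hsub]

theorem count_le_count_one (x : ℝ) {m n : ℕ} (hmn : m ≤ n) : count m x ≤ count n 1 := by
  rw [count_one]
  exact ncard_le_ncard (fun y hy => IsOddRat.mono hy.1 hmn) (finite_oddRats n)

theorem two_le_count_one (m : ℕ) : 2 ≤ count (m + 1) 1 := by
  rw [count_one, ← ncard_pair (zero_ne_one' ℝ)]
  exact ncard_le_ncard (pair_subset (IsOddRat.zero _) (IsOddRat.one m)) (finite_oddRats _)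

theorem count_lowBranch (m : ℕ) {x : ℝ} (hx : x ∈ Icc (0 : ℝ) 1) :
    count (m + 2) (lowBranch x) = count m x :=
  (bijOn_lowBranch m hx).ncard_eq.symm

theorem count_topBranch (m : ℕ) {x : ℝ} (hx : x ∈ Icc (0 : ℝ) 1) :
    count (m + 1) (topBranch x) + count m x =
      count (m + 1) 1 + (oddRats (m + 1) ∩ {topBranch x}).ncard := by
  rw [count_one, ← ncard_inter_Iic_add_ncard_inter_Ici (finite_oddRats _),
    ← (bijOn_topBranch m hx).ncard_eq, count, count]

theorem count_midBranch (m : ℕ) {x : ℝ} (hx : x ∈ Icc (0 : ℝ) 1) :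
    count (m + 4) (midBranch x) + 1 = count (m + 2) 1 + count (m + 1) x := by
  have hthird : (1 / 3 : ℝ) ∈ oddRats (m + 4) ∩ Iic (midBranch x) :=
    ⟨midBranch_zero ▸ (IsOddRat.zero (m + 1)).mid, (mapsTo_midBranch hx).1⟩
  have hlow :
      oddRats (m + 4) ∩ Iic (midBranch x) ∩ Iic (1 / 3) = oddRats (m + 4) ∩ Iic (1 / 3) := by
    rw [inter_assoc, inter_eq_right.2 (Iic_subset_Iic.2 hthird.2)]
  have hsplit := ncard_inter_Iic_add_ncard_inter_Ici
    ((finite_oddRats (m + 4)).inter_of_left (Iic (midBranch x))) (1 / 3)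
  rw [hlow, ← (bijOn_midBranch m hx).ncard_eq, inter_eq_right.2 (singleton_subset_iff.2 hthird),
    ncard_singleton, ← lowBranch_one] at hsplit
  rw [← count_lowBranch (m + 2) (by simp)]
  exact hsplit.symm

theorem count_one_recurrence (m : ℕ) :
    count (m + 4) 1 + 2 = count (m + 3) 1 + count (m + 2) 1 + count (m + 1) 1 := by
  have htop := count_topBranch (m + 3) (x := 1) (by simp)
  have hmid := count_midBranch m (x := 1) (by simp)
  have hhalf : topBranch 1 ∈ oddRats (m + 4) := (IsOddRat.one (m + 2)).top
  rw [inter_eq_right.2 (singleton_subset_iff.2 hhalf), ncard_singleton, topBranch_one,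
    show m + 3 + 1 = m + 4 from rfl] at htop
  rw [midBranch_one] at hmid
  omega

theorem count_one_sub_one_recurrence (m : ℕ) : (count (m + 4) 1 - 1 : ℝ) =
    (count (m + 3) 1 - 1) + (count (m + 2) 1 - 1) + (count (m + 1) 1 - 1) := by
  have : (count (m + 4) 1 + 2 : ℝ) = count (m + 3) 1 + count (m + 2) 1 + count (m + 1) 1 := by
    exact_mod_cast count_one_recurrence m
  linarith

theorem Fn_eq (n : ℕ) (x : ℝ) : Fn n x = count (n + 1) x / count (n + 1) 1 := by
  have hinj : Function.Injective ((↑) : ℚ → ℝ) := Rat.cast_injective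
  have hsep : ((↑) : ℚ → ℝ) '' {ξ ∈ Y n | (ξ : ℝ) ≤ x} = oddRats (n + 1) ∩ Iic x := by
    rw [← image_ratCast_Y, ← image_inter_preimage]
    rfl
  rw [Fn, ← ncard_image_of_injective _ hinj, ← ncard_image_of_injective (Y n) hinj, hsep,
    image_ratCast_Y, count_one, count]

section Limit

variable {lam x : ℝ} (hlam : lam ^ 3 - lam ^ 2 - lam - 1 = 0)

/-- The failure of `count m x` to grow by the exact factor `lam` from `m` to `m + 1`. -/
noncomputable def defect (lam : ℝ) (m : ℕ) (x : ℝ) : ℝ := count (m + 1) x - lam * count m x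

theorem defect_lowBranch (lam : ℝ) (m : ℕ) (hx : x ∈ Icc (0 : ℝ) 1) :
    defect lam (m + 2) (lowBranch x) = defect lam m x := by
  rw [defect, count_lowBranch m hx, show m + 2 + 1 = m + 1 + 2 from rfl,
    count_lowBranch (m + 1) hx, defect]

theorem abs_defect_midBranch_le (hlam_one : 1 ≤ lam) (m : ℕ) (hx : x ∈ Icc (0 : ℝ) 1) :
    |defect lam (m + 4) (midBranch x)| ≤
      |defect lam (m + 1) x| + |defect lam (m + 2) 1| + lam := by
  have h₀ : (count (m + 4) (midBranch x) : ℝ) + 1 = count (m + 2) 1 + count (m + 1) x := by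
    exact_mod_cast count_midBranch m hx
  have h₁ : (count (m + 5) (midBranch x) : ℝ) + 1 = count (m + 3) 1 + count (m + 2) x := by
    exact_mod_cast count_midBranch (m + 1) hx
  have hdefect : defect lam (m + 4) (midBranch x) =
      defect lam (m + 1) x + defect lam (m + 2) 1 + (lam - 1) := by
    simp only [defect]
    linear_combination h₁ - lam * h₀
  rw [hdefect]
  refine (abs_add_three _ _ _).trans ?_
  rw [abs_of_nonneg (sub_nonneg.2 hlam_one)]
  linarith

theorem abs_defect_topBranch_le (hlam_one : 1 ≤ lam) (m : ℕ) (hx : x ∈ Icc (0 : ℝ) 1) :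
    |defect lam (m + 1) (topBranch x)| ≤
      |defect lam m x| + |defect lam (m + 1) 1| + lam := by
  have h₀ : (count (m + 1) (topBranch x) : ℝ) + count m x =
      count (m + 1) 1 + (oddRats (m + 1) ∩ {topBranch x}).ncard := by
    exact_mod_cast count_topBranch m hx
  have h₁ : (count (m + 2) (topBranch x) : ℝ) + count (m + 1) x =
      count (m + 2) 1 + (oddRats (m + 2) ∩ {topBranch x}).ncard := by
    exact_mod_cast count_topBranch (m + 1) hx
  set ε₀ : ℝ := ((oddRats (m + 1) ∩ {topBranch x}).ncard : ℝ)
  set ε₁ : ℝ := ((oddRats (m + 2) ∩ {topBranch x}).ncard : ℝ)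
  have hdefect : defect lam (m + 1) (topBranch x) =
      -defect lam m x + defect lam (m + 1) 1 + (ε₁ - lam * ε₀) := by
    simp only [defect]
    linear_combination h₁ - lam * h₀
  have herror : |ε₁ - lam * ε₀| ≤ lam := by
    have hε₀ : 0 ≤ ε₀ := Nat.cast_nonneg _
    have hε₁ : 0 ≤ ε₁ := Nat.cast_nonneg _
    have hε₀' : ε₀ ≤ 1 := Nat.cast_le_one.2 (ncard_inter_singleton_le_one _ _)
    have hε₁' : ε₁ ≤ 1 := Nat.cast_le_one.2 (ncard_inter_singleton_le_one _ _)
    rw [abs_le]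
    constructor <;> nlinarith
  rw [hdefect]
  refine (abs_add_three _ _ _).trans ?_
  rw [abs_neg]
  linarith

/-- The limit of `count m x / lam ^ m`; normalised by its value at `1`, it is `F0`. -/
noncomputable def limitCount (lam x : ℝ) : ℝ := limUnder atTop fun m => count m x / lam ^ m

include hlam

theorem exists_abs_defect_one_le : ∃ K, ∀ m, |defect lam (m + 1) 1| ≤ K := by
  obtain ⟨K, hK⟩ := exists_abs_sub_mul_le_of_tribonacci hlam
    (u := fun m => (count (m + 1) 1 : ℝ) - 1) count_one_sub_one_recurrence
  refine ⟨K + |1 - lam|, fun m => ?_⟩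
  have hdefect : defect lam (m + 1) 1 =
      (count (m + 2) 1 - 1) - lam * (count (m + 1) 1 - 1) + (1 - lam) := by
    rw [defect]
    ring
  rw [hdefect]
  exact (abs_add_le _ _).trans (add_le_add_left (hK m) _)

theorem exists_abs_defect_le :
    ∃ B C : ℝ, ∀ (m : ℕ), ∀ x ∈ Icc (0 : ℝ) 1, |defect lam m x| ≤ B + C * m := by
  have h1 := one_lt_of_tribonacci hlam
  obtain ⟨K, hK⟩ := exists_abs_defect_one_le hlam
  have hC : 0 ≤ K + lam := by linarith [(abs_nonneg _).trans (hK 0)]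
  refine ⟨(1 + lam) * count 4 1, K + lam, fun m => ?_⟩
  induction m using Nat.strong_induction_on with
  | _ m ih =>
    intro x hx
    obtain hm | ⟨k, rfl⟩ : m < 4 ∨ ∃ k, m = k + 4 :=
      (lt_or_ge m 4).imp_right Nat.exists_eq_add_of_le'
    · have hsucc : (count (m + 1) x : ℝ) ≤ count 4 1 := by
        exact_mod_cast count_le_count_one x hm
      have hself : (count m x : ℝ) ≤ count 4 1 := by
        exact_mod_cast count_le_count_one x hm.le
      have hsmall : |defect lam m x| ≤ (1 + lam) * count 4 1 := by
        refine (abs_sub _ _).trans ?_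
        rw [abs_mul, Nat.abs_cast, Nat.abs_cast, abs_of_pos (by linarith), add_mul, one_mul]
        gcongr
      have : 0 ≤ (K + lam) * m := by positivity
      linarith
    · obtain ⟨y, hy, rfl | rfl | rfl⟩ := exists_branch_eq hx
      · rw [defect_lowBranch lam (k + 2) hy]
        refine (ih (k + 2) (by omega) y hy).trans ?_
        gcongr
        omega
      · refine (abs_defect_midBranch_le h1.le k hy).trans ?_
        have := ih (k + 1) (by omega) y hy
        push_cast at this ⊢
        linarith [hK (k + 1)]
      · refine (abs_defect_topBranch_le h1.le (k + 3) hy).trans ?_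
        have := ih (k + 3) (by omega) y hy
        push_cast at this ⊢
        linarith [hK (k + 3)]

theorem tendsto_limitCount (hx : x ∈ Icc (0 : ℝ) 1) :
    Tendsto (fun m => count m x / lam ^ m) atTop (𝓝 (limitCount lam x)) := by
  have h1 := one_lt_of_tribonacci hlam
  obtain ⟨B, C, hBC⟩ := exists_abs_defect_le hlam
  exact tendsto_nhds_limUnder (exists_tendsto_div_pow (a := fun m => (count m x : ℝ)) (by linarith)
    (fun m => hBC m x hx) (summable_add_mul_div_pow h1 B C))

theorem limitCount_one_pos : 0 < limitCount lam 1 := by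
  have h1 := one_lt_of_tribonacci hlam
  have : 0 < lam := by linarith
  have hgrowth (m : ℕ) : 1 / lam ^ 2 * lam ^ m ≤ count (m + 1) 1 - 1 := by
    refine mul_pow_le_of_tribonacci hlam (u := fun m => (count (m + 1) 1 : ℝ) - 1)
      count_one_sub_one_recurrence (fun k hk => ?_) m
    have hcount : (2 : ℝ) ≤ count (k + 1) 1 := by exact_mod_cast two_le_count_one k
    have hpow : lam ^ k ≤ lam ^ 2 := pow_le_pow_right₀ h1.le (by omega)
    rw [one_div_mul_eq_div]
    linarith [(div_le_one (by positivity)).2 hpow]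
  have hlim := (tendsto_limitCount hlam (x := 1) (by simp)).comp (tendsto_add_atTop_nat 1)
  refine lt_of_lt_of_le (by positivity : 0 < 1 / lam ^ 3) (ge_of_tendsto' hlim fun m => ?_)
  calc 1 / lam ^ 3 = 1 / lam ^ 2 * lam ^ m / lam ^ (m + 1) := by field_simp; ring
    _ ≤ count (m + 1) 1 / lam ^ (m + 1) := by gcongr; linarith [hgrowth m]

theorem tendsto_Fn (hx : x ∈ Icc (0 : ℝ) 1) :
    Tendsto (fun n => Fn n x) atTop (𝓝 (limitCount lam x / limitCount lam 1)) := by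
  have h1 := one_lt_of_tribonacci hlam
  have hdiv := ((tendsto_limitCount hlam hx).div (tendsto_limitCount hlam (x := 1) (by simp))
    (limitCount_one_pos hlam).ne').comp (tendsto_add_atTop_nat 1)
  refine hdiv.congr fun n => ?_
  rw [Fn_eq, Function.comp_apply, Pi.div_apply, div_div_div_cancel_right₀ (by positivity)]

theorem F0_eq (hx : x ∈ Icc (0 : ℝ) 1) : F0 x = limitCount lam x / limitCount lam 1 :=
  (tendsto_Fn hlam hx).limUnder_eq

theorem limitCount_lowBranch (hx : x ∈ Icc (0 : ℝ) 1) :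
    limitCount lam (lowBranch x) = limitCount lam x / lam ^ 2 := by
  have hy := lowBranch_mem_Icc hx
  refine tendsto_nhds_unique ((tendsto_limitCount hlam hy).comp (tendsto_add_atTop_nat 2))
    (((tendsto_limitCount hlam hx).div_const (lam ^ 2)).congr fun m => ?_)
  rw [Function.comp_apply, count_lowBranch m hx, pow_add, div_div]

theorem limitCount_topBranch (hx : x ∈ Icc (0 : ℝ) 1) :
    limitCount lam (topBranch x) = limitCount lam 1 - limitCount lam x / lam := by
  have h1 := one_lt_of_tribonacci hlam
  have hy := topBranch_mem_Icc hx
  have herror : Tendsto (fun m => ((oddRats (m + 1) ∩ {topBranch x}).ncard : ℝ) / lam ^ (m + 1))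
      atTop (𝓝 0) := by
    have hinv := (tendsto_inv_atTop_zero.comp (tendsto_pow_atTop_atTop_of_one_lt h1)).comp
      (tendsto_add_atTop_nat 1)
    refine squeeze_zero (fun m => by positivity) (fun m => ?_) hinv
    rw [Function.comp_apply, Function.comp_apply, ← one_div]
    gcongr
    exact_mod_cast ncard_inter_singleton_le_one _ _
  have hone := (tendsto_limitCount hlam (x := 1) (by simp)).comp (tendsto_add_atTop_nat 1)
  have hlim := (hone.add herror).sub ((tendsto_limitCount hlam hx).div_const lam)
  rw [add_zero] at hlim
  refine tendsto_nhds_unique ((tendsto_limitCount hlam hy).comp (tendsto_add_atTop_nat 1))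
    (hlim.congr fun m => ?_)
  have hcount : (count (m + 1) (topBranch x) : ℝ) + count m x =
      count (m + 1) 1 + (oddRats (m + 1) ∩ {topBranch x}).ncard := by
    exact_mod_cast count_topBranch m hx
  simp only [Function.comp_apply]
  rw [← add_div, ← hcount, div_div, ← pow_succ, ← sub_div, add_sub_cancel_right]

theorem F0_lowBranch (hx : x ∈ Icc (0 : ℝ) 1) : F0 (lowBranch x) = F0 x / lam ^ 2 := by
  have hy := lowBranch_mem_Icc hx
  rw [F0_eq hlam hy, F0_eq hlam hx, limitCount_lowBranch hlam hx, div_right_comm]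

theorem F0_topBranch (hx : x ∈ Icc (0 : ℝ) 1) : F0 (topBranch x) = 1 - F0 x / lam := by
  have hy := topBranch_mem_Icc hx
  rw [F0_eq hlam hy, F0_eq hlam hx, limitCount_topBranch hlam hx, sub_div,
    div_self (limitCount_one_pos hlam).ne', div_right_comm]

theorem F0_lowBranch_iterate (n : ℕ) (hx : x ∈ Icc (0 : ℝ) 1) :
    F0 (lowBranch^[n] x) = F0 x / lam ^ (2 * n) := by
  have hmaps : MapsTo lowBranch (Icc 0 1) (Icc 0 1) := fun _ => lowBranch_mem_Icc
  induction n with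
  | zero => simp
  | succ n ih =>
    rw [Function.iterate_succ_apply', F0_lowBranch hlam (hmaps.iterate n hx), ih, div_div,
      ← pow_add, mul_add_one]

theorem F0_one_div_odd_add {n : ℕ} (hn : 1 ≤ n) (hx : x ∈ Icc (0 : ℝ) 1) :
    F0 x / lam ^ (2 * n - 1) = 1 / lam ^ (2 * n - 2) - F0 (1 / (2 * (n : ℝ) - 1 + x)) := by
  obtain ⟨k, rfl⟩ := Nat.exists_eq_add_of_le' hn
  have hy := topBranch_mem_Icc hx
  have hiter : lowBranch^[k] (topBranch x) = 1 / (2 * ((k + 1 : ℕ) : ℝ) - 1 + x) := by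
    rw [topBranch, lowBranch_iterate_one_div (by linarith [hx.1])]
    push_cast
    ring
  rw [← hiter, F0_lowBranch_iterate hlam k hy, F0_topBranch hlam hx,
    show 2 * (k + 1) - 1 = 2 * k + 1 by omega, show 2 * (k + 1) - 2 = 2 * k by omega, sub_div,
    div_div, ← pow_succ', sub_sub_cancel]

end Limit

end OddCF

/-- The first conjunct says that the limit defining `F⁰` exists on `[0, 1]`. The last equation is
the second functional equation at `x = 0`, where `1 / (2n + 1/x)` is read as `0`. -/
theorem proposition2 (lam : ℝ) (hlam : lam ^ 3 - lam ^ 2 - lam - 1 = 0) :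
    (∀ x ∈ Set.Icc (0 : ℝ) 1,
      Tendsto (fun n : ℕ => OddCF.Fn n x) atTop (𝓝 (OddCF.F0 x))) ∧
    ∀ n : ℕ, 1 ≤ n →
      (∀ x ∈ Set.Icc (0 : ℝ) 1,
        OddCF.F0 x / lam ^ (2 * n - 1) =
          1 / lam ^ (2 * n - 2) - OddCF.F0 (1 / (2 * (n : ℝ) - 1 + x))) ∧
      (∀ x ∈ Set.Ioc (0 : ℝ) 1,
        OddCF.F0 x / lam ^ (2 * n) = OddCF.F0 (1 / (2 * (n : ℝ) + 1 / x))) ∧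
      OddCF.F0 0 / lam ^ (2 * n) = OddCF.F0 0 := by
  refine ⟨fun x hx => ?_, fun n hn => ⟨fun x hx => ?_, fun x hx => ?_, ?_⟩⟩
  · rw [OddCF.F0_eq hlam hx]
    exact OddCF.tendsto_Fn hlam hx
  · exact OddCF.F0_one_div_odd_add hlam hn hx
  · rw [← OddCF.lowBranch_iterate_one_div (one_div_pos.2 hx.1), one_div_one_div,
      OddCF.F0_lowBranch_iterate hlam n ⟨hx.1.le, hx.2⟩]
  · rw [← OddCF.F0_lowBranch_iterate hlam n (by simp),
      Function.iterate_fixed OddCF.lowBranch_zero]
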